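/- Let $p$ be an odd prime number and let $E$ be an elliptic curve over $\mathbb{Q}$ with good reduction at $p$. For $n\ge 1$ put $K_n=\mathbb{Q}(\mu_{p^n})$, where $\mu_{p^n}$ is the group of $p^n$-th roots of unity, and for a finite place $v$ of $K_n$ let $K_{n,v}$ be the completion of $K_n$ at $v$. Then there is a quadratic twist $E'/\mathbb{Q}$ of $E$ such that $$E'(K_{n,v})[p]=0$$ for every integer $n\ge 1$ and every finite place $v$ of $K_n$ at which the base change $E'_{K_{n,v}}$ has potentially multiplicative reduction (that is, acquires multiplicative reduction over some finite extension of $K_{n,v}$). Here a quadratic twist of $E$ means one of the elliptic curves $E^{(d)}: d\,y^2=x^3+a_2x^2+a_4x+a_6$ with $d\in\mathbb{Q}^\times$, where $y^2=x^3+a_2x^2+a_4x+a_6$ is a Weierstrass equation of $E$ over $\mathbb{Q}$; the trivial twist ($d$ a square) is allowed. -/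

import Mathlib

open NumberField IsDedekindDomain

noncomputable section

namespace WeierstrassCurve

universe u

/-- The quadratic twist by `d` of a Weierstrass curve over a field of characteristic `≠ 2`.
Completing the square turns `W` into `y² = x³ + (b₂/4) x² + (b₄/2) x + b₆/4`; the twist is
`d y² = x³ + (b₂/4) x² + (b₄/2) x + b₆/4`, made monic by `(x, y) ↦ (x/d, y/d²)`.
If `W` is `y² = x³ + a x + b`, it is `y² = x³ + d² a x + d³ b`. -/
def quadraticTwist {K : Type*} [Field K] (W : WeierstrassCurve K) (d : K) : WeierstrassCurve K where
  a₁ := 0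
  a₂ := d * W.b₂ / 4
  a₃ := 0
  a₄ := d ^ 2 * W.b₄ / 2
  a₆ := d ^ 3 * W.b₆ / 4

section Reduction

variable (R : Type*) [CommRing R] [IsDomain R] [IsDiscreteValuationRing R]
variable {K : Type u} [Field K] [Algebra R K] [IsFractionRing R K]

/-- The curve over `K` has good reduction with respect to `R`: one of its (minimal) Weierstrass
equations has. -/
def CurveHasGoodReduction (W : WeierstrassCurve K) : Prop :=
  ∃ C : VariableChange K, (C • W).HasGoodReduction R

/-- The curve over `K` has multiplicative reduction with respect to `R`: one of its (minimal)
Weierstrass equations has. -/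
def CurveHasMultiplicativeReduction (W : WeierstrassCurve K) : Prop :=
  ∃ C : VariableChange K, (C • W).HasMultiplicativeReduction R

/-- The curve over `K` has potentially multiplicative reduction with respect to `R`: there are a
finite extension `L` of `K` and a discrete valuation ring `S` of `L` lying over `R` (when `K` is
complete, the ring of integers of `L` is the only one) such that the base change of the curve to `L`
has multiplicative reduction with respect to `S`. -/
def CurveHasPotentiallyMultiplicativeReduction (W : WeierstrassCurve K) : Prop :=
  ∃ (L : Type u) (_ : Field L) (_ : Algebra K L) (_ : FiniteDimensional K L)
    (S : ValuationSubring L) (_ : IsDiscreteValuationRing S),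
    (∀ x : K, algebraMap K L x ∈ S ↔ x ∈ (algebraMap R K).range) ∧
      (W.baseChange L).CurveHasMultiplicativeReduction S

end Reduction

/-- The base change of a curve over `ℚ` to the completion `K_v` of a number field `K` at a finite
place `v`. -/
def localize (W : WeierstrassCurve ℚ) {K : Type*} [Field K] [NumberField K]
    (v : HeightOneSpectrum (𝓞 K)) : WeierstrassCurve (v.adicCompletion K) :=
  (W.baseChange K).baseChange (v.adicCompletion K)

open scoped Classical in
/-- Condition (C2) for `(W, p)`: for all `n ≥ 1` and all finite places `v` of `Kₙ = ℚ(μ_{pⁿ})` where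
the base change of `W` to `K_{n,v}` has potentially multiplicative reduction,
`W(K_{n,v})[p] = 0`. -/
def ConditionC2 (p : ℕ) [Fact p.Prime] (W : WeierstrassCurve ℚ) : Prop :=
  ∀ n : ℕ, 1 ≤ n → ∀ v : HeightOneSpectrum (𝓞 (CyclotomicField (p ^ n) ℚ)),
    (W.localize v).CurveHasPotentiallyMultiplicativeReduction
      (v.adicCompletionIntegers (CyclotomicField (p ^ n) ℚ)) →
    ∀ P : (W.localize v).toAffine.Point, p • P = 0 → P = 0

end WeierstrassCurve

end

/-! Potentially multiplicative reduction at `v` makes `j = c₄³/Δ` non-integral there, so `v` lies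
over a prime `ℓ` dividing the denominator of `j`. Good reduction at `p` forces `ℓ ≠ p`, hence `ℓ` is
unramified in `Kₙ`. Choose `d` so that `d c₆/(4c₄)` has odd valuation at every such `ℓ`; the
valuation stays odd at `v`. The twist is then, over `K_{n,v}`, a Tate curve twisted by a ramified
quadratic character, and inertia fixes no point of odd prime order `p ≠ ℓ`.

The last claim is proved by explicit formulas, without Tate curves (`nodalTwist_torsion_eq_zero`).
The twist is `y² = μ³ f(z)` with `f = z³ - z² - 9ηz + η`, where `μ = d c₆/(4c₄)` and `η = 64Δ/c₆²`
is small. As `v μ` is not a square in the value group, neither is `v (f z)` at a `p`-torsion point.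
This forces doubling to push the point outwards: from `v z < 1` (reduction to the node) to `v z ≥
1`, and from `v z = 1` to `v z > 1`. In the region `v z > 1`, that of the formal group, `1/z(nP) ≈
n²/z(P)`, which excludes `p`-torsion because `p` is a unit (`nodalTwist_nsmul_ne_zero`). -/

namespace WeierstrassCurve

/-! ### Group law on the twisted nodal cubic, in the coordinate `z` -/

section NodalCubic

variable {K : Type*} [Field K]

/-- The curve `y² = (x - ρ)³ - μ (x - ρ)² - 9 η μ² (x - ρ) + η μ³`: in the coordinate `z` with
`x = μ z + ρ`, it is the twist `y² = μ³ (z³ - z² - 9 η z + η)` of a deformation of a nodal cubic. -/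
def nodalTwist (μ ρ η : K) : WeierstrassCurve K where
  a₁ := 0
  a₂ := -μ - 3 * ρ
  a₃ := 0
  a₄ := -9 * η * μ ^ 2 + 2 * ρ * μ + 3 * ρ ^ 2
  a₆ := η * μ ^ 3 + 9 * η * μ ^ 2 * ρ - μ * ρ ^ 2 - ρ ^ 3

variable {μ ρ η : K}

lemma nodalTwist_negY (x y : K) : (nodalTwist μ ρ η).toAffine.negY x y = -y := by
  simp [Affine.negY, nodalTwist]

lemma nodalTwist_addX (x₁ x₂ ℓ : K) :
    (nodalTwist μ ρ η).toAffine.addX x₁ x₂ ℓ = ℓ ^ 2 + μ + 3 * ρ - x₁ - x₂ := by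
  simp only [Affine.addX, nodalTwist]; ring

lemma nodalTwist_equation {z y : K}
    (h : (nodalTwist μ ρ η).toAffine.Equation (μ * z + ρ) y) :
    y ^ 2 = μ ^ 3 * (z ^ 3 - z ^ 2 - 9 * η * z + η) := by
  rw [Affine.equation_iff] at h
  simp only [nodalTwist] at h
  linear_combination h

lemma nodalTwist_exists_coord (hμ : μ ≠ 0) {P : (nodalTwist μ ρ η).toAffine.Point} (hP : P ≠ 0) :
    ∃ (z y : K) (h : (nodalTwist μ ρ η).toAffine.Nonsingular (μ * z + ρ) y),
      P = .some _ _ h := by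
  rcases P with _ | ⟨x, y, h⟩
  · exact (hP rfl).elim
  · obtain ⟨z, rfl⟩ : ∃ z, x = μ * z + ρ := ⟨(x - ρ) / μ, by field_simp; ring⟩
    exact ⟨_, y, h, rfl⟩

variable [DecidableEq K]

lemma nodalTwist_double (h2 : (2 : K) ≠ 0) (hμ : μ ≠ 0) {z y : K}
    (h : (nodalTwist μ ρ η).toAffine.Nonsingular (μ * z + ρ) y) (hy : y ≠ 0) :
    ∃ (z' y' : K) (h' : (nodalTwist μ ρ η).toAffine.Nonsingular (μ * z' + ρ) y'),
      (2 : ℕ) • Affine.Point.some _ _ h = .some _ _ h' ∧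
      (z' - 1 + 2 * z) * (4 * (z ^ 3 - z ^ 2 - 9 * η * z + η)) =
        (3 * z ^ 2 - 2 * z - 9 * η) ^ 2 := by
  have hy' : y ≠ (nodalTwist μ ρ η).toAffine.negY (μ * z + ρ) y := by
    rw [nodalTwist_negY]
    intro e
    exact mul_ne_zero h2 hy (by linear_combination e)
  have hadd := Affine.Point.add_self_of_Y_ne (h₁ := h) hy'
  have hne : Affine.Point.some _ _ h + Affine.Point.some _ _ h ≠ 0 := by
    rw [hadd]; exact Affine.Point.some_ne_zero _
  obtain ⟨z', y', h', e⟩ := nodalTwist_exists_coord hμ hne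
  refine ⟨z', y', h', by rw [two_nsmul, e], ?_⟩
  rw [hadd, Affine.Point.some.injEq, nodalTwist_addX, Affine.slope_of_Y_ne rfl hy',
    nodalTwist_negY] at e
  have e1 := e.1
  have hyy : y - -y = 2 * y := by ring
  rw [hyy] at e1
  have heq := nodalTwist_equation h.1
  simp only [nodalTwist] at e1
  field_simp at e1
  have h3 : μ ^ 4 ≠ 0 := pow_ne_zero _ hμ
  apply mul_left_cancel₀ h3
  linear_combination (-e1) + 4 * (μ * (2 * z + z' - 1)) * (-heq)

/-- The symmetric functions of `z(P+Q)` and `z(P-Q)` are even in each `y`, so the curve equation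
eliminates both ordinates, and `μ` with them. -/
lemma nodalTwist_add_sub (hμ : μ ≠ 0) {z₁ y₁ z₂ y₂ : K}
    (h₁ : (nodalTwist μ ρ η).toAffine.Nonsingular (μ * z₁ + ρ) y₁)
    (h₂ : (nodalTwist μ ρ η).toAffine.Nonsingular (μ * z₂ + ρ) y₂) (hz : z₁ ≠ z₂) :
    ∃ (z₃ y₃ z₄ y₄ : K) (h₃ : (nodalTwist μ ρ η).toAffine.Nonsingular (μ * z₃ + ρ) y₃)
      (h₄ : (nodalTwist μ ρ η).toAffine.Nonsingular (μ * z₄ + ρ) y₄),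
      Affine.Point.some _ _ h₁ + .some _ _ h₂ = .some _ _ h₃ ∧
      Affine.Point.some _ _ h₁ - .some _ _ h₂ = .some _ _ h₄ ∧
      (z₃ + z₄) * (z₁ - z₂) ^ 2 =
        2 * ((z₁ + z₂) * (z₁ * z₂ - 9 * η) - 2 * z₁ * z₂ + 2 * η) ∧
      z₃ * z₄ * (z₁ - z₂) ^ 2 = (z₁ * z₂ + 9 * η) ^ 2 - 4 * η * (z₁ + z₂ - 1) := by
  have hx : μ * z₁ + ρ ≠ μ * z₂ + ρ := by
    intro e; exact hz (mul_left_cancel₀ hμ (add_right_cancel e))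
  have hadd := Affine.Point.add_of_X_ne (h₁ := h₁) (h₂ := h₂) hx
  have h₂' := (Affine.nonsingular_neg ..).mpr h₂
  have hsub := Affine.Point.add_of_X_ne (h₁ := h₁) (h₂ := h₂') hx
  rw [← Affine.Point.neg_some h₂, ← sub_eq_add_neg] at hsub
  have hne : Affine.Point.some _ _ h₁ + .some _ _ h₂ ≠ 0 := by
    rw [hadd]; exact Affine.Point.some_ne_zero _
  have hne' : Affine.Point.some _ _ h₁ - .some _ _ h₂ ≠ 0 := by
    rw [hsub]; exact Affine.Point.some_ne_zero _
  obtain ⟨z₃, y₃, h₃, e₃⟩ := nodalTwist_exists_coord hμ hne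
  obtain ⟨z₄, y₄, h₄, e₄⟩ := nodalTwist_exists_coord hμ hne'
  refine ⟨z₃, y₃, z₄, y₄, h₃, h₄, e₃, e₄, ?_⟩
  rw [hadd, Affine.Point.some.injEq, nodalTwist_addX, Affine.slope_of_X_ne hx] at e₃
  rw [hsub, Affine.Point.some.injEq, nodalTwist_addX, Affine.slope_of_X_ne hx,
    nodalTwist_negY] at e₄
  have E₃ := e₃.1
  have E₄ := e₄.1
  have q₁ := nodalTwist_equation h₁.1
  have q₂ := nodalTwist_equation h₂.1
  have hd : z₁ - z₂ ≠ 0 := sub_ne_zero.mpr hz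
  have hx' : μ * z₁ + ρ - (μ * z₂ + ρ) = μ * (z₁ - z₂) := by ring
  rw [hx'] at E₃ E₄
  have F₃ : (y₁ - y₂) ^ 2 = μ ^ 3 * (z₁ - z₂) ^ 2 * (z₃ + z₁ + z₂ - 1) := by
    field_simp at E₃
    linear_combination E₃
  have F₄ : (y₁ + y₂) ^ 2 = μ ^ 3 * (z₁ - z₂) ^ 2 * (z₄ + z₁ + z₂ - 1) := by
    field_simp at E₄
    linear_combination E₄
  have hsum : (z₃ + z₄) * (z₁ - z₂) ^ 2 =
      2 * ((z₁ + z₂) * (z₁ * z₂ - 9 * η) - 2 * z₁ * z₂ + 2 * η) := by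
    apply mul_left_cancel₀ (pow_ne_zero 3 hμ)
    linear_combination -F₃ - F₄ + 2 * q₁ + 2 * q₂
  refine ⟨hsum, ?_⟩
  -- Multiplying the two chord relations leaves only squares of ordinates; a common factor `μ⁶ (z₁ -
  -- z₂)²` then cancels.
  have hprod : (y₁ ^ 2 - y₂ ^ 2) ^ 2 = (μ ^ 3 * (z₁ - z₂) ^ 2 * (z₃ + z₁ + z₂ - 1)) *
      (μ ^ 3 * (z₁ - z₂) ^ 2 * (z₄ + z₁ + z₂ - 1)) := by
    rw [← F₃, ← F₄]; ring
  rw [q₁, q₂] at hprod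
  apply mul_left_cancel₀ (pow_ne_zero 6 hμ)
  apply mul_left_cancel₀ (pow_ne_zero 2 hd)
  linear_combination -hprod - μ ^ 6 * (z₁ - z₂) ^ 2 * (z₁ + z₂ - 1) * hsum

end NodalCubic

end WeierstrassCurve

namespace WeierstrassCurve

/-! ### No `p`-torsion near the identity -/

section Valued

variable {K Γ₀ : Type*} [Field K] [LinearOrderedCommGroupWithZero Γ₀] {v : Valuation K Γ₀}

lemma valuation_lt_of_mul_one_add_eq {τ : K} {t u s : v.integer} (ht₀ : (t : K) ≠ 0)
    (ht : v t < 1) (h : τ * (1 + t * u) = t ^ 2 * s) : v (1 + t * u : K) = 1 ∧ v τ < v t := by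
  have hu : v (t * u : K) < 1 := by
    rw [map_mul]; exact mul_lt_one_of_lt_of_le ht u.2
  have h1 : v (1 + t * u : K) = 1 := by
    rw [Valuation.map_add_eq_of_lt_left _ (by rwa [map_one]), map_one]
  refine ⟨h1, ?_⟩
  have h2 := congrArg v h
  rw [map_mul, h1, mul_one, map_mul, map_pow] at h2
  have hv₀ : 0 < v t := (Valuation.pos_iff _).mpr ht₀
  calc v τ = v t ^ 2 * v s := h2
    _ ≤ v t ^ 2 * 1 := mul_le_mul_right s.2 _
    _ = v t * v t := by rw [mul_one, pow_two]
    _ < v t * 1 := (mul_lt_mul_iff_right₀ hv₀).mpr ht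
    _ = v t := mul_one _

/-- An approximate parallelogram law for `t = 1/z`: dividing the sum formula by the product formula
gives `t₃ + t₄`, equal to `2(t₁ + t₂)` up to a multiple of `t₁²`. -/
lemma valuation_add_sub_recurrence {η t₁ t₂ t₄ z₁ z₂ z₃ z₄ : K} (hη : v η ≤ 1) (ht₀ : t₁ ≠ 0)
    (ht : v t₁ < 1) (ht₂ : v t₂ ≤ v t₁)
    (e₁ : z₁ * t₁ = 1) (e₂ : z₂ * t₂ = 1) (e₄ : z₄ * t₄ = 1)
    (hs : (z₃ + z₄) * (z₁ - z₂) ^ 2 =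
      2 * ((z₁ + z₂) * (z₁ * z₂ - 9 * η) - 2 * z₁ * z₂ + 2 * η))
    (hp : z₃ * z₄ * (z₁ - z₂) ^ 2 = (z₁ * z₂ + 9 * η) ^ 2 - 4 * η * (z₁ + z₂ - 1)) :
    ∃ t₃, z₃ * t₃ = 1 ∧ v (t₃ + t₄ - 2 * (t₁ + t₂)) < v t₁ := by
  -- With `t₂ = t₁ w` and `w` integral, all error terms become integral polynomials in `η`, `t`,
  -- `w`, collected in `u` and `s`.
  obtain ⟨w, rfl⟩ : ∃ w, t₂ = t₁ * w := ⟨t₂ / t₁, by field_simp⟩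
  have hv₀ : 0 < v t₁ := (Valuation.pos_iff _).mpr ht₀
  have hw : v w ≤ 1 := by
    rw [map_mul] at ht₂
    exact (mul_le_mul_iff_right₀ hv₀).mp (by simpa using ht₂)
  lift η to v.integer using hη
  lift w to v.integer using hw
  obtain ⟨t, rfl⟩ : ∃ t : v.integer, (t : K) = t₁ := ⟨⟨t₁, ht.le⟩, rfl⟩
  obtain ⟨u, hu⟩ : ∃ u : v.integer, (u : K) = 18 * η * t * w + 81 * η ^ 2 * t ^ 3 * w ^ 2
    - 4 * η * t * w * (t + t * w - t ^ 2 * w) :=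
    ⟨18 * η * t * w + 81 * η ^ 2 * t ^ 3 * w ^ 2 - 4 * η * t * w * (t + t * w - t ^ 2 * w), rfl⟩
  obtain ⟨s, hs'⟩ : ∃ s : v.integer, (s : K) = 2 * (-9 * η * t * w * (1 + w) - 2 * w
    + 2 * η * t ^ 2 * w ^ 2) :=
    ⟨2 * (-9 * η * t * w * (1 + w) - 2 * w + 2 * η * t ^ 2 * w ^ 2), rfl⟩
  have hp' : z₃ * z₄ * (t - t * w : K) ^ 2 = 1 + t * u := by
    obtain rfl : z₁ = (t : K)⁻¹ := eq_inv_of_mul_eq_one_left e₁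
    obtain rfl : z₂ = (t * w : K)⁻¹ := eq_inv_of_mul_eq_one_left e₂
    have hw₀ : (w : K) ≠ 0 := fun h ↦ by simp [h] at e₂
    rw [hu]
    field_simp at hp
    linear_combination hp
  have hs'' : (z₃ + z₄) * (t - t * w : K) ^ 2 = 2 * t * (1 + w) + t ^ 2 * s := by
    obtain rfl : z₁ = (t : K)⁻¹ := eq_inv_of_mul_eq_one_left e₁
    obtain rfl : z₂ = (t * w : K)⁻¹ := eq_inv_of_mul_eq_one_left e₂
    have hw₀ : (w : K) ≠ 0 := fun h ↦ by simp [h] at e₂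
    rw [hs']
    field_simp at hs
    linear_combination (t : K) * hs
  have hU : (1 + t * u : K) ≠ 0 := by
    have := (valuation_lt_of_mul_one_add_eq (τ := 0) (t := t) (u := u) (s := 0) ht₀ ht
      (by simp)).1
    rw [← Valuation.ne_zero_iff v, this]; exact one_ne_zero
  have hz₃ : z₃ ≠ 0 := by
    rintro rfl; exact hU (hp'.symm.trans (by ring))
  refine ⟨z₃⁻¹, mul_inv_cancel₀ hz₃, ?_⟩
  obtain ⟨t₃, ht₃⟩ : ∃ t₃, z₃ * t₃ = 1 := ⟨z₃⁻¹, mul_inv_cancel₀ hz₃⟩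
  rw [← eq_inv_of_mul_eq_one_right ht₃]
  obtain ⟨r, hr⟩ : ∃ r : v.integer, (r : K) = s - 2 * (1 + w) * u := ⟨s - 2 * (1 + w) * u, rfl⟩
  refine (valuation_lt_of_mul_one_add_eq (u := u) (s := r) ht₀ ht ?_).2
  have key : (t₃ + t₄) * (1 + t * u : K) = 2 * t * (1 + w) + t ^ 2 * s := by
    rw [← hp', ← hs'']
    linear_combination (z₄ * (t - t * w : K) ^ 2) * ht₃ + (z₃ * (t - t * w : K) ^ 2) * e₄
  rw [hr]
  linear_combination key

lemma valuation_double {η t z z' : K} (hη : v η ≤ 1) (ht₀ : t ≠ 0) (ht : v t < 1) (e : z * t = 1)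
    (h : (z' - 1 + 2 * z) * (4 * (z ^ 3 - z ^ 2 - 9 * η * z + η)) =
        (3 * z ^ 2 - 2 * z - 9 * η) ^ 2) :
    ∃ t', z' * t' = 1 ∧ v (t' - 4 * t) < v t := by
  lift η to v.integer using hη
  obtain ⟨t, rfl⟩ : ∃ s : v.integer, (s : K) = t := ⟨⟨t, ht.le⟩, rfl⟩
  obtain ⟨u, hu⟩ : ∃ u : v.integer, (u : K) = 18 * η * t - 8 * η * t ^ 2
      + (81 * η ^ 2 + 4 * η) * t ^ 3 :=
    ⟨18 * η * t - 8 * η * t ^ 2 + (81 * η ^ 2 + 4 * η) * t ^ 3, rfl⟩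
  obtain ⟨s, hs⟩ : ∃ s : v.integer, (s : K) = 4 * (-1 - 9 * η * t + η * t ^ 2) - 4 * u :=
    ⟨4 * (-1 - 9 * η * t + η * t ^ 2) - 4 * u, rfl⟩
  have hU : (1 + t * u : K) ≠ 0 := by
    have := (valuation_lt_of_mul_one_add_eq (τ := 0) (t := t) (u := u) (s := 0) ht₀ ht
      (by simp)).1
    rw [← Valuation.ne_zero_iff v, this]; exact one_ne_zero
  have key : z' * (4 * (t - t ^ 2 - 9 * η * t ^ 3 + η * t ^ 4)) = (1 + t * u : K) := by
    obtain rfl : z = (t : K)⁻¹ := eq_inv_of_mul_eq_one_left e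
    rw [hu]
    field_simp at h
    linear_combination h
  have hz' : z' ≠ 0 := by
    rintro rfl; exact hU (key.symm.trans (zero_mul _))
  obtain ⟨t', ht'⟩ : ∃ t', z' * t' = 1 := ⟨z'⁻¹, mul_inv_cancel₀ hz'⟩
  refine ⟨t', ht', (valuation_lt_of_mul_one_add_eq (u := u) (s := s) ht₀ ht ?_).2⟩
  rw [hs]
  linear_combination -t' * key + (4 * (t - t ^ 2 - 9 * η * t ^ 3 + η * t ^ 4)) * ht'

lemma valuation_ofNat_le_one (v : Valuation K Γ₀) (n : ℕ) : v (n : K) ≤ 1 := (n : v.integer).2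

variable [DecidableEq K] {μ ρ η : K}

/-- A point of prime order `p ≠ 2` reducing to the identity has reciprocal coordinates of its
multiples given to first order by `1 / z(nP) ≈ n² / z(P)`. -/
lemma nodalTwist_nsmul_approx (h2 : (2 : K) ≠ 0) (hμ : μ ≠ 0) (hη : v η ≤ 1) {p : ℕ}
    (hp : p.Prime) (hp2 : p ≠ 2) {z y : K}
    {h : (nodalTwist μ ρ η).toAffine.Nonsingular (μ * z + ρ) y} (hz : 1 < v z)
    (hP : p • Affine.Point.some _ _ h = 0) {n : ℕ} (hn : 1 ≤ n) (hnp : n < p) :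
    ∃ (z' y' t' : K) (h' : (nodalTwist μ ρ η).toAffine.Nonsingular (μ * z' + ρ) y'),
      n • Affine.Point.some _ _ h = .some _ _ h' ∧ z' * t' = 1 ∧
        v (t' - n ^ 2 * z⁻¹) < v z⁻¹ := by
  set P := Affine.Point.some _ _ h with hPdef
  have hord : addOrderOf P = p :=
    have := Fact.mk hp
    addOrderOf_eq_prime hP (Affine.Point.some_ne_zero h)
  have hsmul {m : ℕ} (hm : m ≠ 0) (hmp : m < p) : m • P ≠ 0 := fun e ↦
    Nat.not_dvd_of_pos_of_lt (Nat.pos_of_ne_zero hm) hmp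
      (hord ▸ addOrderOf_dvd_of_nsmul_eq_zero e)
  have hp3 : 2 < p := lt_of_le_of_ne hp.two_le hp2.symm
  have hz₀ : z ≠ 0 := fun e ↦ by simp [e] at hz
  have ht₀ : z⁻¹ ≠ 0 := inv_ne_zero hz₀
  have ht : v z⁻¹ < 1 := by rw [map_inv₀]; exact inv_lt_one_of_one_lt₀ hz
  have hzt : z * z⁻¹ = 1 := mul_inv_cancel₀ hz₀
  have hbound {m : ℕ} {t' : K} (ht' : v (t' - m ^ 2 * z⁻¹) < v z⁻¹) : v t' ≤ v z⁻¹ := by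
    have : t' = (t' - m ^ 2 * z⁻¹) + (m ^ 2 : ℕ) * z⁻¹ := by push_cast; ring
    rw [this]
    refine (Valuation.map_add_le _ ht'.le ?_)
    rw [map_mul]
    exact mul_le_of_le_one_left' (valuation_ofNat_le_one v _)
  induction n using Nat.strong_induction_on with
  | _ n ih =>
  match n, hn with
  | 1, _ => exact ⟨z, y, z⁻¹, h, one_nsmul _, hzt, by simpa using (Valuation.pos_iff v).mpr ht₀⟩
  -- The chord formulas need distinct `z`, so `2P` is treated by the tangent.
  | 2, _ =>
    have hy : y ≠ 0 := by
      rintro rfl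
      refine hsmul two_ne_zero hp3 ?_
      rw [two_nsmul, hPdef]
      exact Affine.Point.add_self_of_Y_eq (by rw [nodalTwist_negY, neg_zero])
    obtain ⟨z', y', h', e, hd⟩ := nodalTwist_double h2 hμ h hy
    obtain ⟨t', ht', hv⟩ := valuation_double hη ht₀ ht hzt hd
    exact ⟨z', y', t', h', e, ht', by
      simpa only [Nat.cast_ofNat, show (2 : K) ^ 2 = 4 by norm_num] using hv⟩
  | n + 3, _ =>
    obtain ⟨z₂, y₂, t₂, h₂, e₂, ht₂, hv₂⟩ := ih (n + 2) (by omega) (by omega) (by omega)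
    obtain ⟨z₄, y₄, t₄, h₄, e₄, ht₄, hv₄⟩ := ih (n + 1) (by omega) (by omega) (by omega)
    have hne : z₂ ≠ z := by
      rintro rfl
      rcases (Affine.Point.X_eq_iff (h₁ := h₂) (h₂ := h)).mp rfl with e | e
      · rw [← e₂, ← hPdef] at e
        exact hsmul (m := n + 1) (by omega) (by omega)
          (by rw [add_nsmul, two_nsmul, ← add_assoc] at e; simpa [add_nsmul] using e)
      · rw [← e₂, ← hPdef] at e
        exact hsmul (m := n + 3) (by omega) (by omega)
          (by rw [show n + 3 = n + 2 + 1 by omega, add_nsmul, e]; simp)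
    -- For `P` and `(n+2)P`, the sum is `(n+3)P` and the difference is `-(n+1)P`, which shares its
    -- `z` with `(n+1)P`. The induction closes by `(n+3)² = 2(1 + (n+2)²) - (n+1)²`.
    obtain ⟨z₃, y₃, z₄', y₄', h₃, h₄', e₃, e₄', hs, hprod⟩ := nodalTwist_add_sub hμ h h₂ hne.symm
    have hz₄ : z₄' = z₄ := by
      have : -((n + 1) • P) = P - (n + 2) • P := by
        simp only [add_nsmul, two_nsmul, one_nsmul]; abel
      rw [← hPdef, ← e₂, ← this, e₄, Affine.Point.neg_some, Affine.Point.some.injEq] at e₄'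
      exact (mul_left_cancel₀ hμ (add_right_cancel e₄'.1)).symm
    subst hz₄
    obtain ⟨t₃, ht₃, hv₃⟩ := valuation_add_sub_recurrence hη ht₀ ht (hbound hv₂) hzt ht₂ ht₄ hs hprod
    refine ⟨z₃, y₃, t₃, h₃, ?_, ht₃, ?_⟩
    · rw [← e₃, ← e₂, ← hPdef, ← succ_nsmul']
    · have : t₃ - ((n + 3 : ℕ) : K) ^ 2 * z⁻¹ = (t₃ + t₄ - 2 * (z⁻¹ + t₂))
          + ((2 : ℕ) * (t₂ - ((n + 2 : ℕ) : K) ^ 2 * z⁻¹)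
          - (t₄ - ((n + 1 : ℕ) : K) ^ 2 * z⁻¹)) := by push_cast; ring
      rw [this]
      refine Valuation.map_add_lt _ hv₃ (Valuation.map_sub_lt _ ?_ hv₄)
      rw [map_mul]
      exact (mul_le_of_le_one_left' (valuation_ofNat_le_one v _)).trans_lt hv₂

/-- Write `p = 2m+1`. If `pP = 0`, then `(m+1)P = -mP` has the same `z` as `mP`, while the
approximations differ by `((m+1)² - m²)/z = p/z`, too large when `p` is a unit. -/
lemma nodalTwist_nsmul_ne_zero (h2 : (2 : K) ≠ 0) (hμ : μ ≠ 0) (hη : v η ≤ 1) {p : ℕ}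
    (hp : p.Prime) (hp2 : p ≠ 2) (hvp : v (p : K) = 1) {z y : K}
    {h : (nodalTwist μ ρ η).toAffine.Nonsingular (μ * z + ρ) y} (hz : 1 < v z) :
    p • Affine.Point.some _ _ h ≠ 0 := by
  intro hP
  have hp3 : 2 < p := lt_of_le_of_ne hp.two_le hp2.symm
  obtain ⟨m, hm⟩ := hp.odd_of_ne_two hp2
  obtain ⟨z₁, y₁, t₁, h₁, e₁, ht₁, hv₁⟩ :=
    nodalTwist_nsmul_approx h2 hμ hη hp hp2 hz hP (n := m) (by omega) (by omega)
  obtain ⟨z₂, y₂, t₂, h₂, e₂, ht₂, hv₂⟩ :=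
    nodalTwist_nsmul_approx h2 hμ hη hp hp2 hz hP (n := m + 1) (by omega) (by omega)
  have hneg : (m + 1) • Affine.Point.some _ _ h = -(m • Affine.Point.some _ _ h) := by
    rw [eq_neg_iff_add_eq_zero, ← add_nsmul, show m + 1 + m = p by omega, hP]
  rw [e₁, e₂, Affine.Point.neg_some, Affine.Point.some.injEq] at hneg
  obtain rfl := mul_left_cancel₀ hμ (add_right_cancel hneg.1)
  obtain rfl : t₁ = t₂ := by
    rw [eq_inv_of_mul_eq_one_right ht₁, eq_inv_of_mul_eq_one_right ht₂]
  have := Valuation.map_sub_lt _ hv₁ hv₂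
  rw [show t₁ - (m : K) ^ 2 * z⁻¹ - (t₁ - ((m + 1 : ℕ) : K) ^ 2 * z⁻¹) = p * z⁻¹ by
    rw [hm]; push_cast; ring, map_mul, hvp, one_mul] at this
  exact this.false

end Valued

end WeierstrassCurve

namespace WeierstrassCurve

/-! ### Doubling pushes torsion points towards the identity -/

section ValuedDouble

variable {K Γ₀ : Type*} [Field K] [LinearOrderedCommGroupWithZero Γ₀] {v : Valuation K Γ₀}

lemma valuation_add_sq_lt {a b : K} {c : Γ₀} (ha : v a ^ 2 < c) (hb : v b ^ 2 < c) :
    v (a + b) ^ 2 < c := by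
  rcases le_max_iff.mp (v.map_add a b) with h | h
  · exact (pow_le_pow_left' h 2).trans_lt ha
  · exact (pow_le_pow_left' h 2).trans_lt hb

lemma valuation_natCast_mul_le (n : ℕ) (x : K) : v (n * x) ≤ v x := by
  rw [map_mul]; exact mul_le_of_le_one_left' (valuation_ofNat_le_one v n)

/-- A non-square valuation prevents `f z` from being a unit, so `z` reduces to `1`, the simple root
of `z³ - z²`. There `f'` is a unit, and the tangent formula has a pole. -/
lemma valuation_double_of_eq_one {η z z' : K} (hη : v η < 1) (hz : v z = 1)
    (hsq : ∀ g, v (z ^ 3 - z ^ 2 - 9 * η * z + η) ≠ g ^ 2)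
    (h : (z' - 1 + 2 * z) * (4 * (z ^ 3 - z ^ 2 - 9 * η * z + η)) =
        (3 * z ^ 2 - 2 * z - 9 * η) ^ 2) : 1 < v z' := by
  have h9 : v (9 * η) < 1 := (valuation_natCast_mul_le 9 η).trans_lt hη
  have h9z : v (9 * η * z) < 1 := by rwa [map_mul, hz, mul_one]
  have h2z : v (2 * z) ≤ 1 := (valuation_natCast_mul_le 2 z).trans hz.le
  set f := z ^ 3 - z ^ 2 - 9 * η * z + η with hf
  have hf1 : v f < 1 := by
    refine lt_of_le_of_ne ?_ (by simpa using hsq 1)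
    refine v.map_add_le (v.map_sub_le (v.map_sub_le ?_ ?_) h9z.le) hη.le <;> simp [hz]
  have hz1 : v (z - 1) < 1 := by
    have : z ^ 2 * (z - 1) = f + 9 * η * z - η := by rw [hf]; ring
    have h' : v (z ^ 2 * (z - 1)) < 1 := by
      rw [this]; exact v.map_sub_lt (v.map_add_lt hf1 h9z) hη
    simpa [hz] using h'
  have hf' : v (3 * z ^ 2 - 2 * z - 9 * η) = 1 := by
    have : 3 * z ^ 2 - 2 * z - 9 * η = z + ((3 : ℕ) * (z * (z - 1)) - 9 * η) := by
      push_cast; ring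
    rw [this, v.map_add_eq_of_lt_left, hz]
    rw [hz]
    refine v.map_sub_lt ((valuation_natCast_mul_le _ _).trans_lt ?_) h9
    rwa [map_mul, hz, one_mul]
  have hD : 1 < v (z' - 1 + 2 * z) := by
    by_contra! hle
    have := congrArg v h
    rw [map_mul, map_pow, hf', one_pow] at this
    exact ((mul_le_of_le_one_left' hle).trans_lt
      ((valuation_natCast_mul_le 4 f).trans_lt hf1)).ne this
  have : z' = (z' - 1 + 2 * z) + (1 - 2 * z) := by ring
  have h12 : v (1 - 2 * z) ≤ 1 := v.map_sub_le (map_one v).le h2z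
  rwa [this, v.map_add_eq_of_lt_left (h12.trans_lt hD)]

/-- Near the node, compare `η` with `z²`, the leading terms of `f`. If `z²` dominates, `v f` is a
square; if they balance, cancellation in `f` makes `z'` large; if `η` dominates, `z'` reduces to
`1`. -/
lemma valuation_double_of_lt_one {η z z' : K} (hη : v η < v 64) (hz : v z < 1)
    (hsq : ∀ g, v (z ^ 3 - z ^ 2 - 9 * η * z + η) ≠ g ^ 2)
    (h : (z' - 1 + 2 * z) * (4 * (z ^ 3 - z ^ 2 - 9 * η * z + η)) =
        (3 * z ^ 2 - 2 * z - 9 * η) ^ 2) : 1 ≤ v z' := by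
  have h4 : v (4 : K) ≤ 1 := valuation_ofNat_le_one v 4
  have h2 : v (2 : K) ≤ 1 := valuation_ofNat_le_one v 2
  have h22 : v (2 : K) ^ 2 = v 4 := by rw [← map_pow]; norm_num
  have h64 : v (64 : K) ≤ v 4 := by
    have := valuation_natCast_mul_le (v := v) 16 (4 : K)
    norm_num at this; exact this
  have hη4 : v η < v 4 := hη.trans_le h64
  have h40 : v (4 : K) ≠ 0 := ne_zero_of_lt hη4
  have hη1 : v η < 1 := hη4.trans_le h4
  have h9 : v (9 * η) ≤ v η := valuation_natCast_mul_le 9 η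
  have h2z : v (2 * z) < 1 := (valuation_natCast_mul_le 2 z).trans_lt hz
  have hzz : v (z ^ 3) ≤ v (z ^ 2) := by
    rw [pow_succ, map_mul]; exact mul_le_of_le_one_right' hz.le
  have hηz : v (9 * η * z) ≤ v η := by
    rw [map_mul]; exact (mul_le_of_le_one_right' hz.le).trans h9
  have h3z : v (3 * z ^ 2) ≤ v (z ^ 2) := valuation_natCast_mul_le 3 (z ^ 2)
  set f := z ^ 3 - z ^ 2 - 9 * η * z + η with hf
  have hv := congrArg v h
  rw [map_mul, map_mul, map_pow] at hv
  rcases lt_trichotomy (v η) (v (z ^ 2)) with hlt | heq | hgt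
  · have hz0 : v z ≠ 0 := by
      intro h0; rw [map_pow, h0] at hlt; simp at hlt
    have : f = -z ^ 2 + (z ^ 3 - 9 * η * z + η) := by rw [hf]; ring
    refine absurd ?_ (hsq (v z))
    rw [this, v.map_add_eq_of_lt_left]
    · simp
    · have : v (-z ^ 2) = v (z ^ 2) := v.map_neg _
      rw [this]
      refine v.map_add_lt (v.map_sub_lt ?_ (hηz.trans_lt hlt)) hlt
      rw [pow_succ, map_mul]
      exact mul_lt_of_lt_one_right (zero_lt_iff.mpr (by simpa using hz0)) hz
  · have hfle : v f ≤ v η := by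
      refine v.map_add_le (v.map_sub_le (v.map_sub_le ?_ heq.ge) hηz) le_rfl
      exact hzz.trans heq.ge
    have hflt : v f < v η := lt_of_le_of_ne hfle (by rw [heq, map_pow]; exact hsq _)
    have hz0 : 0 < v z := by
      rw [zero_lt_iff]; rintro h0
      rw [heq, map_pow, h0] at hflt; simp at hflt
    -- As `64 = 8²`, the bound on `η` gives `v z < v 8`, so `2z` dominates `f'` even in residue
    -- characteristic `2`.
    have hz2 : v z < v 2 := by
      have h8 : v z < v 8 := by
        rw [heq, show (64 : K) = 8 ^ 2 by norm_num, map_pow, map_pow] at hη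
        exact lt_of_pow_lt_pow_left' 2 hη
      have := valuation_natCast_mul_le (v := v) 4 (2 : K)
      norm_num at this; exact h8.trans_le this
    have hf' : v (3 * z ^ 2 - 2 * z - 9 * η) = v (2 * z) := by
      have : 3 * z ^ 2 - 2 * z - 9 * η = -(2 * z) + (3 * z ^ 2 - 9 * η) := by ring
      rw [this, v.map_add_eq_of_lt_left, v.map_neg]
      rw [v.map_neg]
      refine (v.map_sub_le h3z (h9.trans heq.le)).trans_lt ?_
      rw [map_pow, map_mul, pow_two]
      exact (mul_lt_mul_iff_left₀ hz0).mpr hz2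
    have hD : 1 < v (z' - 1 + 2 * z) := by
      by_contra! hle
      rw [hf', map_mul, mul_pow, h22, ← map_pow, ← heq] at hv
      have : v (z' - 1 + 2 * z) * (v 4 * v f) < v 4 * v η :=
        (mul_le_of_le_one_left' hle).trans_lt
          ((mul_lt_mul_iff_right₀ (zero_lt_iff.mpr h40)).mpr hflt)
      exact this.ne hv
    have : z' = (z' - 1 + 2 * z) + (1 - 2 * z) := by ring
    have h12 : v (1 - 2 * z) ≤ 1 := v.map_sub_le (map_one v).le h2z.le
    rw [this, v.map_add_eq_of_lt_left (h12.trans_lt hD)]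
    exact hD.le
  · have hη0 : 0 < v η := lt_of_le_of_lt zero_le hgt
    have hfη : v f = v η := by
      have : f = η + (z ^ 3 - z ^ 2 - 9 * η * z) := by rw [hf]; ring
      rw [this, v.map_add_eq_of_lt_left]
      refine v.map_sub_lt (v.map_sub_lt (hzz.trans_lt hgt) hgt) ?_
      rw [map_mul]
      exact (mul_le_mul_left h9 _).trans_lt (mul_lt_of_lt_one_right hη0 hz)
    have hηη : v η ^ 2 < v 4 * v η := by
      rw [pow_two]; exact (mul_lt_mul_iff_left₀ hη0).mpr hη4
    have hf' : v (3 * z ^ 2 - 2 * z - 9 * η) ^ 2 < v 4 * v η := by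
      have : 3 * z ^ 2 - 2 * z - 9 * η = 3 * z ^ 2 + (-(2 * z) + -(9 * η)) := by ring
      rw [this]
      refine valuation_add_sq_lt ?_ (valuation_add_sq_lt ?_ ?_)
      · exact (pow_le_pow_left' (h3z.trans hgt.le) 2).trans_lt hηη
      · rw [v.map_neg, map_mul, mul_pow, h22, ← map_pow]
        exact (mul_lt_mul_iff_right₀ (zero_lt_iff.mpr h40)).mpr hgt
      · rw [v.map_neg]
        exact (pow_le_pow_left' h9 2).trans_lt hηη
    have hD : v (z' - 1 + 2 * z) < 1 := by
      by_contra! hle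
      rw [hfη] at hv
      rw [← hv] at hf'
      exact (le_mul_of_one_le_left' hle).not_gt hf'
    have : z' = 1 + ((z' - 1 + 2 * z) - 2 * z) := by ring
    rw [this, v.map_add_eq_of_lt_left] <;> rw [map_one]
    exact v.map_sub_lt hD h2z

variable [DecidableEq K] {μ ρ η : K}

/-- The `p`-torsion of the twist of a nodal degeneration by a class of odd valuation vanishes, for
odd primes `p` different from the residue characteristic. -/
theorem nodalTwist_torsion_eq_zero (hμ : ∀ g, v μ ≠ g ^ 2) (hη : v η < v 64) {p : ℕ}
    (hp : p.Prime) (hp2 : p ≠ 2) (hvp : v (p : K) = 1)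
    {P : (nodalTwist μ ρ η).toAffine.Point} (hP : p • P = 0) : P = 0 := by
  have hμ0 : μ ≠ 0 := by rintro rfl; exact hμ 0 (by simp)
  have h64 : (64 : K) ≠ 0 := by
    rw [← v.ne_zero_iff]; exact ne_zero_of_lt hη
  have h2 : (2 : K) ≠ 0 := fun h ↦ h64 (by rw [show (64 : K) = 2 * 32 by norm_num, h, zero_mul])
  have hη1 : v η < 1 := hη.trans_le (valuation_ofNat_le_one v 64)
  have hdeep {z y : K} {h : (nodalTwist μ ρ η).toAffine.Nonsingular (μ * z + ρ) y}
      (hz : 1 < v z) : p • Affine.Point.some _ _ h ≠ 0 :=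
    nodalTwist_nsmul_ne_zero h2 hμ0 hη1.le hp hp2 hvp hz
  have hy {z y : K} {h : (nodalTwist μ ρ η).toAffine.Nonsingular (μ * z + ρ) y}
      (hP : p • Affine.Point.some _ _ h = 0) : y ≠ 0 := by
    rintro rfl
    have h2P : 2 • Affine.Point.some _ _ h = 0 := by
      rw [two_nsmul]
      exact Affine.Point.add_self_of_Y_eq (by rw [nodalTwist_negY, neg_zero])
    obtain ⟨m, hm⟩ := hp.odd_of_ne_two hp2
    rw [hm, add_nsmul, mul_comm, mul_nsmul, one_nsmul, smul_comm, h2P, smul_zero, zero_add] at hP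
    exact Affine.Point.some_ne_zero _ hP
  have hsq {z y : K} (h : (nodalTwist μ ρ η).toAffine.Nonsingular (μ * z + ρ) y)
      (hP : p • Affine.Point.some _ _ h = 0) (g : Γ₀) :
      -- Since `y² = μ³ f z` is nonzero, a square `v (f z)` would make `v μ` a square.
      v (z ^ 3 - z ^ 2 - 9 * η * z + η) ≠ g ^ 2 := by
    intro hg
    have e := congrArg v (nodalTwist_equation h.1)
    rw [map_mul, map_pow, map_pow, hg] at e
    have hvμ : v μ ≠ 0 := (v.ne_zero_iff).mpr hμ0
    have hvy : v y ≠ 0 := (v.ne_zero_iff).mpr (hy hP)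
    have hg0 : g ≠ 0 := by
      rintro rfl
      rw [zero_pow two_ne_zero, mul_zero] at e
      exact pow_ne_zero 2 hvy e
    apply hμ (v y / (g * v μ))
    rw [div_pow, e]
    field_simp
  have hdouble {z y : K} (h : (nodalTwist μ ρ η).toAffine.Nonsingular (μ * z + ρ) y)
      (hP : p • Affine.Point.some _ _ h = 0) :
      ∃ (z' y' : K) (h' : (nodalTwist μ ρ η).toAffine.Nonsingular (μ * z' + ρ) y'),
        p • Affine.Point.some _ _ h' = 0 ∧
        (z' - 1 + 2 * z) * (4 * (z ^ 3 - z ^ 2 - 9 * η * z + η)) =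
          (3 * z ^ 2 - 2 * z - 9 * η) ^ 2 := by
    obtain ⟨z', y', h', e, hd⟩ := nodalTwist_double h2 hμ0 h (hy hP)
    exact ⟨z', y', h', by rw [← e, smul_comm, hP, smul_zero], hd⟩
  have hunit {z y : K} (h : (nodalTwist μ ρ η).toAffine.Nonsingular (μ * z + ρ) y)
      (hz : v z = 1) : p • Affine.Point.some _ _ h ≠ 0 := by
    intro hP
    obtain ⟨z', y', h', hP', hd⟩ := hdouble h hP
    exact hdeep (valuation_double_of_eq_one hη1 hz (hsq h hP) hd) hP'
  by_contra hP0
  obtain ⟨z, y, h, rfl⟩ := nodalTwist_exists_coord hμ0 hP0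
  rcases lt_trichotomy (v z) 1 with hz | hz | hz
  · obtain ⟨z', y', h', hP', hd⟩ := hdouble h hP
    rcases (valuation_double_of_lt_one hη hz (hsq h hP) hd).eq_or_lt with hz' | hz'
    · exact hunit h' hz'.symm hP'
    · exact hdeep hz' hP'
  · exact hunit h hz hP
  · exact hdeep hz hP

end ValuedDouble

end WeierstrassCurve

namespace WeierstrassCurve

/-! ### The `j`-invariant, twists, and the nodal normal form -/

section JInvariant

variable {K : Type*} [Field K]

lemma variableChange_c₄_cube_div_Δ (W : WeierstrassCurve K) (C : VariableChange K) :
    (C • W).c₄ ^ 3 / (C • W).Δ = W.c₄ ^ 3 / W.Δ := by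
  rw [variableChange_c₄, variableChange_Δ, mul_pow, ← pow_mul]
  exact mul_div_mul_left _ _ (pow_ne_zero _ C.u⁻¹.ne_zero)

lemma baseChange_c₄_cube_div_Δ (W : WeierstrassCurve K) (L : Type*) [Field L] [Algebra K L] :
    (W.baseChange L).c₄ ^ 3 / (W.baseChange L).Δ = algebraMap K L (W.c₄ ^ 3 / W.Δ) := by
  simp [baseChange]

lemma quadraticTwist_Δ (h2 : (2 : K) ≠ 0) (W : WeierstrassCurve K) (d : K) :
    (W.quadraticTwist d).Δ = d ^ 6 * W.Δ := by
  have h4 : (4 : K) ≠ 0 := by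
    rw [show (4 : K) = 2 * 2 by norm_num]; exact mul_ne_zero h2 h2
  have e₂ : (W.quadraticTwist d).b₂ = d * W.b₂ := by
    simp only [quadraticTwist, b₂]; field_simp; ring
  have e₄ : (W.quadraticTwist d).b₄ = d ^ 2 * W.b₄ := by
    simp only [quadraticTwist, b₄]; field_simp; ring
  have e₆ : (W.quadraticTwist d).b₆ = d ^ 3 * W.b₆ := by
    simp only [quadraticTwist, b₆]; field_simp; ring
  have e₈ : (W.quadraticTwist d).b₈ = d ^ 4 * W.b₈ := by
    apply mul_left_cancel₀ h4
    rw [b_relation, e₂, e₄, e₆]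
    linear_combination -d ^ 4 * W.b_relation
  rw [Δ, Δ, e₂, e₄, e₆, e₈]
  ring

lemma quadraticTwist_c₄ (h2 : (2 : K) ≠ 0) (W : WeierstrassCurve K) (d : K) :
    (W.quadraticTwist d).c₄ = d ^ 2 * W.c₄ := by
  have h4 : (4 : K) ≠ 0 := by
    rw [show (4 : K) = 2 * 2 by norm_num]; exact mul_ne_zero h2 h2
  simp only [quadraticTwist, c₄, b₂, b₄]; field_simp; ring

lemma quadraticTwist_c₄_cube_div_Δ (h2 : (2 : K) ≠ 0) (W : WeierstrassCurve K) {d : K}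
    (hd : d ≠ 0) :
    (W.quadraticTwist d).c₄ ^ 3 / (W.quadraticTwist d).Δ = W.c₄ ^ 3 / W.Δ := by
  rw [quadraticTwist_c₄ h2, quadraticTwist_Δ h2, mul_pow, ← pow_mul]
  exact mul_div_mul_left _ _ (pow_ne_zero _ hd)

/-- In the short form `X³ - (c₄/48) X - c₆/864`, with `X = x + b₂/12`, put `X = (c₆/(12c₄))(3z -
1)`. This makes the linear and constant terms both multiples of `c₄³ - c₆² = 1728 Δ`. -/
lemma quadraticTwist_eq_nodalTwist [CharZero K] (W : WeierstrassCurve K) (d : K) (h₄ : W.c₄ ≠ 0)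
    (h₆ : W.c₆ ≠ 0) :
    W.quadraticTwist d = nodalTwist (d * (W.c₆ / (4 * W.c₄)))
      (d * (-W.b₂ / 12 - W.c₆ / (12 * W.c₄))) (64 * W.Δ / W.c₆ ^ 2) := by
  have hΔ : W.Δ = (W.c₄ ^ 3 - W.c₆ ^ 2) / 1728 := by
    rw [← c_relation]; field_simp
  have hb₄ : W.b₄ = (W.b₂ ^ 2 - W.c₄) / 24 := by
    rw [c₄]; ring
  have hb₆ : W.b₆ = (-W.b₂ ^ 3 + 36 * W.b₂ * W.b₄ - W.c₆) / 216 := by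
    rw [c₆]; ring
  rw [hb₄] at hb₆
  rw [hΔ]
  ext <;> simp only [quadraticTwist, nodalTwist]
  · field_simp; ring
  · rw [hb₄]; field_simp; ring
  · rw [hb₆]; field_simp; ring

lemma nodalTwist_map {L : Type*} [Field L] (f : K →+* L) (μ ρ η : K) :
    (nodalTwist μ ρ η).map f = nodalTwist (f μ) (f ρ) (f η) := by
  ext <;> simp [nodalTwist, map_ofNat f]

end JInvariant

/-! ### Reduction type and integrality of `j` -/

section Reduction

universe u

open IsDiscreteValuationRing

/-- Multiplicative reduction means `c₄` is a unit and `Δ` is not, so `j` is not integral over `L`;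
`j` lies in `K` and `S` lies over `R`. -/
lemma CurveHasPotentiallyMultiplicativeReduction.notMem_range {R : Type*} [CommRing R]
    [IsDomain R] [IsDiscreteValuationRing R] {K : Type u} [Field K] [Algebra R K]
    [IsFractionRing R K] {W : WeierstrassCurve K}
    (hW : W.Δ ≠ 0) (h : W.CurveHasPotentiallyMultiplicativeReduction R) :
    W.c₄ ^ 3 / W.Δ ∉ (algebraMap R K).range := by
  obtain ⟨L, _, _, _, S, _, hS, C, hC⟩ := h
  rw [← hS, ← baseChange_c₄_cube_div_Δ, ← variableChange_c₄_cube_div_Δ _ C]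
  intro hmem
  have hle : (maximalIdeal S).valuation L ((C • W.baseChange L).c₄ ^ 3 / (C • W.baseChange L).Δ)
      ≤ 1 := (maximalIdeal S).valuation_le_one (K := L) ⟨_, hmem⟩
  have hΔ : (C • W.baseChange L).Δ ≠ 0 := by
    rw [variableChange_Δ, baseChange, map_Δ]
    exact mul_ne_zero (pow_ne_zero _ C.u⁻¹.ne_zero) ((map_ne_zero _).mpr hW)
  rw [map_div₀, map_pow, hC.multiplicativeReduction, one_pow, one_div] at hle
  exact hle.not_gt (one_lt_inv₀ (zero_lt_iff.mpr (((maximalIdeal S).valuation L).ne_zero_iff.mpr hΔ))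
    |>.mpr hC.badReduction)

lemma HasGoodReduction.c₄_cube_div_Δ_mem_range {R : Type*} [CommRing R] [IsDomain R]
    [IsDiscreteValuationRing R] {K : Type*} [Field K] [Algebra R K] [IsFractionRing R K]
    {W : WeierstrassCurve K} (h : W.HasGoodReduction R) :
    W.c₄ ^ 3 / W.Δ ∈ (algebraMap R K).range := by
  have hle : (maximalIdeal R).valuation K (algebraMap R K (W.integralModel R).c₄) ≤ 1 :=
    (maximalIdeal R).valuation_le_one _
  rw [integralModel_c₄_eq] at hle
  obtain ⟨r, hr⟩ := exists_lift_of_le_one (A := R) (x := W.c₄ ^ 3 / W.Δ) (by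
    rw [map_div₀, map_pow, h.goodReduction, div_one]
    exact pow_le_one' hle 3)
  exact ⟨r, hr⟩

lemma CurveHasGoodReduction.not_dvd_den {p : ℕ} [Fact p.Prime] {E : WeierstrassCurve ℚ}
    (h : (E.baseChange ℚ_[p]).CurveHasGoodReduction ℤ_[p]) : ¬ p ∣ (E.c₄ ^ 3 / E.Δ).den := by
  obtain ⟨C, hC⟩ := h
  have hmem := hC.c₄_cube_div_Δ_mem_range
  rw [variableChange_c₄_cube_div_Δ, baseChange_c₄_cube_div_Δ] at hmem
  obtain ⟨r, hr⟩ := hmem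
  have hn : ‖((E.c₄ ^ 3 / E.Δ : ℚ) : ℚ_[p])‖ ≤ 1 := by
    have : ((E.c₄ ^ 3 / E.Δ : ℚ) : ℚ_[p]) = algebraMap ℚ ℚ_[p] (E.c₄ ^ 3 / E.Δ) := rfl
    rw [this, ← hr]
    exact r.2
  rw [Padic.norm_rat_le_one_iff_padicValuation_le_one, Rat.padicValuation_le_one_iff] at hn
  exact hn

end Reduction

end WeierstrassCurve

/-! ### Valuations of rationals at places unramified over `ℓ` -/

section Unramified

open WithZero IsDedekindDomain.HeightOneSpectrum

variable {K : Type*} [Field K] [NumberField K]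

lemma valuation_natCast_eq_one_of_coprime (v : HeightOneSpectrum (𝓞 K)) {a b : ℕ}
    (ha : (a : 𝓞 K) ∈ v.asIdeal) (hab : a.Coprime b) : v.valuation K (b : K) = 1 := by
  have h : (b : 𝓞 K) ∉ v.asIdeal := by
    intro hb
    have hc : IsCoprime (a : 𝓞 K) b := by
      simpa using (Nat.isCoprime_iff_coprime.mpr hab).map (Int.castRingHom (𝓞 K))
    obtain ⟨x, y, hxy⟩ := hc
    exact v.isPrime.ne_top ((Ideal.eq_top_iff_one _).mpr
      (hxy ▸ add_mem (Ideal.mul_mem_left _ _ ha) (Ideal.mul_mem_left _ _ hb)))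
  have := (v.valuation_eq_one_iff_notMem (K := K)).mpr h
  simpa using this

lemma valuation_rat_eq_exp (v : HeightOneSpectrum (𝓞 K)) {ℓ : ℕ} [Fact ℓ.Prime]
    (hmem : (ℓ : 𝓞 K) ∈ v.asIdeal) (hℓ : v.valuation K (ℓ : K) = exp (-1 : ℤ)) {x : ℚ}
    (hx : x ≠ 0) : v.valuation K (algebraMap ℚ K x) = exp (-padicValRat ℓ x) := by
  have hnat {n : ℕ} (hn : n ≠ 0) : v.valuation K (n : K) = exp (-(padicValNat ℓ n : ℤ)) := by
    obtain ⟨k, m, hm, rfl⟩ := Nat.exists_eq_pow_mul_and_not_dvd hn ℓ (Fact.out : ℓ.Prime).ne_one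
    have hm0 : m ≠ 0 := by rintro rfl; exact hm (dvd_zero _)
    have hcop : ℓ.Coprime m := ((Fact.out : ℓ.Prime).coprime_iff_not_dvd).mpr hm
    rw [padicValNat.mul (pow_ne_zero _ (Fact.out : ℓ.Prime).ne_zero) hm0,
      padicValNat.prime_pow, padicValNat.eq_zero_of_not_dvd hm, Nat.cast_mul, Nat.cast_pow,
      map_mul, map_pow, hℓ, valuation_natCast_eq_one_of_coprime v hmem hcop, mul_one, ← exp_nsmul]
    simp
  have hint {n : ℤ} (hn : n ≠ 0) : v.valuation K (n : K) = exp (-(padicValInt ℓ n : ℤ)) := by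
    rw [padicValInt, ← hnat (Int.natAbs_ne_zero.mpr hn)]
    rcases Int.natAbs_eq n with h | h
    · conv_lhs => rw [h]
      simp
    · conv_lhs => rw [h]
      simp
  rw [padicValRat_def]
  conv_lhs => rw [← Rat.num_div_den x]
  rw [map_div₀, map_div₀, map_intCast, map_natCast, hint (Rat.num_ne_zero.mpr hx), hnat x.den_ne_zero,
    ← exp_sub]
  congr 1; ring

lemma valuation_cyclotomic_eq_exp {n ℓ : ℕ} [NeZero n] [Fact ℓ.Prime] (hℓ : ¬ ℓ ∣ n)
    [IsCyclotomicExtension {n} ℚ K] (v : HeightOneSpectrum (𝓞 K))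
    (hmem : (ℓ : 𝓞 K) ∈ v.asIdeal) : v.valuation K (ℓ : K) = exp (-1 : ℤ) := by
  have hp := v.isPrime
  have hmax : (Ideal.span {(ℓ : ℤ)}).IsMaximal :=
    Int.ideal_span_isMaximal_of_prime ℓ
  have hover : v.asIdeal.LiesOver (Ideal.span {(ℓ : ℤ)}) := by
    constructor
    refine hmax.eq_of_le (Ideal.comap_ne_top _ hp.ne_top) ?_
    rw [Ideal.span_singleton_le_iff_mem]
    simpa [Ideal.under] using hmem
  have hram := IsCyclotomicExtension.Rat.ramificationIdx_eq_of_not_dvd ℓ K v.asIdeal hℓ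
  have hmap : (Ideal.span {(ℓ : ℤ)}).map (algebraMap ℤ (𝓞 K)) = Ideal.span {(ℓ : 𝓞 K)} := by
    simp [Ideal.map_span]
  have hℓ0 : (ℓ : 𝓞 K) ≠ 0 := by exact_mod_cast (Fact.out : ℓ.Prime).ne_zero
  rw [Ideal.IsDedekindDomain.ramificationIdx_eq_multiplicity (Ideal.span {(ℓ : ℤ)}), hmap] at hram
  · have := v.intValuation_eq_exp_neg_multiplicity hℓ0
    rw [hram] at this
    rw [← map_natCast (algebraMap (𝓞 K) K), valuation_of_algebraMap, this]
    simp
  · rw [hmap]; simpa using hℓ0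

end Unramified

/-! ### Choice of the twist, and conclusion -/

lemma exists_nat_forall_odd_padicValRat (S : Finset ℕ) (hS : ∀ ℓ ∈ S, ℓ.Prime) {q : ℚ}
    (hq : q ≠ 0) : ∃ d : ℕ, d ≠ 0 ∧ ∀ ℓ ∈ S, Odd (padicValRat ℓ (d * q)) := by
  induction S using Finset.induction_on with
  | empty => exact ⟨1, one_ne_zero, by simp⟩
  | insert r S hr ih =>
    obtain ⟨d, hd, h⟩ := ih fun ℓ hℓ ↦ hS ℓ (Finset.mem_insert_of_mem hℓ)
    have hrp := hS r (Finset.mem_insert_self r S)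
    by_cases ho : Odd (padicValRat r (d * q))
    · refine ⟨d, hd, fun ℓ hℓ ↦ ?_⟩
      rcases Finset.mem_insert.mp hℓ with rfl | hℓ
      exacts [ho, h ℓ hℓ]
    · have hdq : (d : ℚ) * q ≠ 0 := mul_ne_zero (by exact_mod_cast hd) hq
      have hr0 : (r : ℚ) ≠ 0 := by exact_mod_cast hrp.ne_zero
      -- Multiplying by the prime `r` flips the parity at `r` and at no other prime.
      refine ⟨r * d, mul_ne_zero hrp.ne_zero hd, fun ℓ hℓ ↦ ?_⟩
      have := Fact.mk (hS ℓ hℓ)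
      rw [Nat.cast_mul, mul_assoc, padicValRat.mul hr0 hdq]
      rcases Finset.mem_insert.mp hℓ with rfl | hℓS
      · rw [padicValRat.self hrp.one_lt]
        exact (Int.not_odd_iff_even.mp ho).one_add
      · have hne : ℓ ≠ r := fun e ↦ hr (e ▸ hℓS)
        have := Fact.mk hrp
        rw [padicValRat.of_nat, padicValNat_primes hne]
        simpa using h ℓ hℓS
open WithZero WeierstrassCurve

lemma exists_prime_mem_of_one_lt_valuation {K : Type*} [Field K] [NumberField K]
    (v : HeightOneSpectrum (𝓞 K)) {x : ℚ} (hx : 1 < v.valuation K (algebraMap ℚ K x)) :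
    ∃ ℓ ∈ x.den.primeFactors, (ℓ : 𝓞 K) ∈ v.asIdeal := by
  have hmem : (x.den : 𝓞 K) ∈ v.asIdeal := by
    by_contra hden
    have hd : v.valuation K (x.den : K) = 1 := by
      simpa using (v.valuation_eq_one_iff_notMem (K := K)).mpr hden
    have hn : v.valuation K (x.num : K) ≤ 1 := by
      simpa using v.valuation_le_one (K := K) (x.num : 𝓞 K)
    rw [← Rat.num_div_den x, map_div₀, map_div₀, map_intCast, map_natCast, hd, div_one] at hx
    exact hn.not_gt hx
  have hprod := Nat.prod_primeFactorsList x.den_ne_zero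
  rw [← hprod, Nat.cast_list_prod] at hmem
  have := v.isPrime
  obtain ⟨a, ha, hav⟩ := (Ideal.IsPrime.multiset_prod_mem_iff_exists_mem this
    (x.den.primeFactorsList.map (Nat.cast : ℕ → 𝓞 K) : Multiset (𝓞 K))).mp (by simpa using hmem)
  obtain ⟨ℓ, hℓ, rfl⟩ := List.mem_map.mp (Multiset.mem_coe.mp ha)
  exact ⟨ℓ, by simpa using hℓ, hav⟩

/-- If `c₆ / c₄` twisted by `d` has odd valuation at all primes dividing the denominator of `j`,
then the twist by `d` has no `p`-torsion at the potentially multiplicative places. -/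
lemma WeierstrassCurve.conditionC2_quadraticTwist {p : ℕ} [Fact p.Prime] (hp : p ≠ 2)
    {E : WeierstrassCurve ℚ} (hΔ : E.Δ ≠ 0) (hpj : ¬ p ∣ (E.c₄ ^ 3 / E.Δ).den) {d : ℚ}
    (hd : d ≠ 0)
    (hodd : E.c₄ ≠ 0 → E.c₆ ≠ 0 → ∀ ℓ ∈ (E.c₄ ^ 3 / E.Δ).den.primeFactors,
      Odd (padicValRat ℓ (d * (E.c₆ / (4 * E.c₄))))) :
    (E.quadraticTwist d).ConditionC2 p := by
  intro n hn v hv P hP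
  have hpp : p.Prime := Fact.out
  let K := CyclotomicField (p ^ n) ℚ
  let φ : ℚ →+* v.adicCompletion K := (algebraMap K (v.adicCompletion K)).comp (algebraMap ℚ K)
  let w : Valuation (v.adicCompletion K) (WithZero (Multiplicative ℤ)) := Valued.v
  have hφ (x : ℚ) : w (φ x) = v.valuation K (algebraMap ℚ K x) :=
    v.valuedAdicCompletion_eq_valuation' _
  have hloc (W : WeierstrassCurve ℚ) : W.localize v = W.map φ := map_map W _ _
  have hjE : 1 < w (φ (E.c₄ ^ 3 / E.Δ)) := by
    by_contra! hle
    refine hv.notMem_range ?_ ⟨⟨_, hle⟩, ?_⟩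
    · rw [hloc, map_Δ, quadraticTwist_Δ two_ne_zero]
      exact (map_ne_zero φ).mpr (mul_ne_zero (pow_ne_zero _ hd) hΔ)
    · change φ (E.c₄ ^ 3 / E.Δ) = _
      rw [← quadraticTwist_c₄_cube_div_Δ two_ne_zero E hd, hloc, map_c₄, map_Δ, map_div₀, map_pow]
  have hint (m : ℕ) : w (φ m) ≤ 1 := by rw [map_natCast]; exact valuation_ofNat_le_one w m
  have h₄ : E.c₄ ≠ 0 := by
    intro h; simp [h] at hjE
  -- Here `c₆²/Δ = j - 1728`, and `1728` is negligible against a non-integral `j`. So `c₆ ≠ 0`, and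
  -- `Δ/c₆²` has valuation `< 1`.
  have hj' : w (φ (E.c₆ ^ 2 / E.Δ)) = w (φ (E.c₄ ^ 3 / E.Δ)) := by
    have : E.c₆ ^ 2 / E.Δ = E.c₄ ^ 3 / E.Δ - (1728 : ℕ) := by
      field_simp
      push_cast
      linear_combination E.c_relation
    rw [this, map_sub]
    exact w.map_sub_eq_of_lt_left ((hint 1728).trans_lt hjE)
  have h₆ : E.c₆ ≠ 0 := by
    intro h; rw [← hj'] at hjE; simp [h] at hjE
  obtain ⟨ℓ, hℓj, hℓv⟩ := exists_prime_mem_of_one_lt_valuation v (hφ _ ▸ hjE)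
  have hℓ : ℓ.Prime := Nat.prime_of_mem_primeFactors hℓj
  have := Fact.mk hℓ
  have hℓp : ℓ ≠ p := by
    rintro rfl; exact hpj (Nat.dvd_of_mem_primeFactors hℓj)
  have hcop : ℓ.Coprime p := (Nat.coprime_primes hℓ hpp).mpr hℓp
  have : NeZero (p ^ n) := ⟨pow_ne_zero _ hpp.ne_zero⟩
  have : IsCyclotomicExtension {p ^ n} ℚ K :=
    have : NeZero ((p ^ n : ℕ) : ℚ) := NeZero.charZero
    CyclotomicField.isCyclotomicExtension _ _
  have hunram : v.valuation K (ℓ : K) = exp (-1 : ℤ) :=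
    valuation_cyclotomic_eq_exp (n := p ^ n)
      (fun h ↦ hℓp ((Nat.prime_dvd_prime_iff_eq hℓ hpp).mp (hℓ.dvd_of_dvd_pow h))) v hℓv
  have hμ0 : d * (E.c₆ / (4 * E.c₄)) ≠ 0 := by positivity
  have hμ (g : WithZero (Multiplicative ℤ)) : w (φ (d * (E.c₆ / (4 * E.c₄)))) ≠ g ^ 2 := by
    intro hg
    have hg0 : g ≠ 0 := by
      rintro rfl
      exact hμ0 ((map_eq_zero φ).mp (w.zero_iff.mp (hg.trans (zero_pow two_ne_zero))))
    rw [hφ, valuation_rat_eq_exp v hℓv hunram hμ0, ← exp_log hg0, ← exp_nsmul, exp_inj] at hg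
    refine Int.not_even_iff_odd.mpr (hodd h₄ h₆ ℓ hℓj) ⟨-log g, ?_⟩
    rw [nsmul_eq_mul] at hg
    push_cast at hg
    omega
  have hη : w (φ (64 * E.Δ / E.c₆ ^ 2)) < w 64 := by
    have : 64 * E.Δ / E.c₆ ^ 2 = 64 * (E.c₆ ^ 2 / E.Δ)⁻¹ := by field_simp
    rw [this, map_mul, map_mul, map_ofNat, map_inv₀, map_inv₀]
    refine mul_lt_of_lt_one_right (zero_lt_iff.mpr (w.ne_zero_iff.mpr ?_))
      (inv_lt_one_of_one_lt₀ (hj' ▸ hjE))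
    rw [← map_ofNat φ 64]
    exact (map_ne_zero φ).mpr (by norm_num)
  have hvp : w (p : v.adicCompletion K) = 1 := by
    rw [← map_natCast φ p, hφ, map_natCast]
    exact valuation_natCast_eq_one_of_coprime v hℓv hcop
  have hW : (E.quadraticTwist d).localize v = nodalTwist (φ (d * (E.c₆ / (4 * E.c₄))))
      (φ (d * (-E.b₂ / 12 - E.c₆ / (12 * E.c₄)))) (φ (64 * E.Δ / E.c₆ ^ 2)) := by
    rw [hloc, quadraticTwist_eq_nodalTwist E d h₄ h₆, nodalTwist_map]
  clear hv
  revert P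
  rw [hW]
  intro P hP
  classical
  exact nodalTwist_torsion_eq_zero hμ hη hpp hp hvp hP

theorem mainTheorem9 (p : ℕ) [Fact p.Prime] (hp : Odd p)
    (E : WeierstrassCurve ℚ) [E.IsElliptic]
    (hE : (E.baseChange ℚ_[p]).CurveHasGoodReduction ℤ_[p]) :
    ∃ d : ℚ, d ≠ 0 ∧ (E.quadraticTwist d).IsElliptic ∧
      (E.quadraticTwist d).ConditionC2 p := by
  have hp2 : p ≠ 2 := by rintro rfl; exact absurd hp (by decide)
  have hΔ : E.Δ ≠ 0 := E.isUnit_Δ.ne_zero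
  obtain ⟨d, hd, hodd⟩ : ∃ d : ℕ, d ≠ 0 ∧ (E.c₄ ≠ 0 → E.c₆ ≠ 0 →
      ∀ ℓ ∈ (E.c₄ ^ 3 / E.Δ).den.primeFactors,
        Odd (padicValRat ℓ (d * (E.c₆ / (4 * E.c₄))))) := by
    by_cases h : E.c₆ / (4 * E.c₄) = 0
    -- The quotient vanishes when `c₄` or `c₆` does (division by zero included); the parity
    -- condition is then vacuous.
    · refine ⟨1, one_ne_zero, fun h₄ h₆ ↦ absurd h ?_⟩
      positivity
    · obtain ⟨d, hd, hodd⟩ := exists_nat_forall_odd_padicValRat _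
        (fun ℓ hℓ ↦ Nat.prime_of_mem_primeFactors hℓ) h
      exact ⟨d, hd, fun _ _ ↦ hodd⟩
  have hd' : (d : ℚ) ≠ 0 := Nat.cast_ne_zero.mpr hd
  refine ⟨d, hd', ⟨?_⟩, conditionC2_quadraticTwist hp2 hΔ hE.not_dvd_den hd' hodd⟩
  rw [quadraticTwist_Δ two_ne_zero]
  exact (mul_ne_zero (pow_ne_zero _ hd') hΔ).isUnit
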